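/- Let $(X,\mu)$ be a measure space and let $A$ be a positive self-adjoint (possibly unbounded) operator on the complex Hilbert space $L^2(X,\mu)$. Let $V=(\ker A)^\perp\subset L^2(X,\mu)$, let $\Pi_V$ be the orthogonal projection onto $V$, and for $t>0$ let $$L(t)=\|e^{-tA}\Pi_V\|_{1,\infty}=\sup\{\|e^{-tA}\Pi_V g\|_\infty : g\in L^1\cap L^2,\ \|g\|_1\le 1\}\in[0,\infty],\qquad M(t)=\int_t^{+\infty}L(u)\,du\in[0,\infty].$$ Suppose that $L(t)<+\infty$ and $M(t)<+\infty$ for all $t>0$. For $f\in L^2(X,\mu)$ let $$\mathcal E(f)=\langle Af,f\rangle=\int_{[0,\infty)}\lambda\,d\langle \Pi_\lambda f,f\rangle\in[0,\infty]$$ be its energy, where $d\langle\Pi_\lambda f,f\rangle$ is the spectral measure of $f$ with respect to $A$ (so $\mathcal E(f)=\|A^{1/2}f\|_2^2$ if $f\in D(A^{1/2})$, and $\mathcal E(f)=+\infty$ otherwise). Then every non-zero $f\in V$ of finite energy satisfies $$\int_X N\Bigl(\frac{|f(x)|^2}{4\,\mathcal E(f)}\Bigr)\,d\mu(x)\le \ln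 2,$$ where $N(y)=y/M^{-1}(y)$ and $M^{-1}(y)=\inf\{t>0 : M(t)\le y\}$ is the right continuous inverse of $M$, with the conventions $\inf\emptyset=+\infty$, $N(0)=0$, and $N(y)=+\infty$ if $y>0$ and $M^{-1}(y)=0$. -/

import Mathlib

open MeasureTheory
open scoped ENNReal InnerProductSpace CompactlySupported

noncomputable section

namespace HeatSobolev

section Abstract

variable {H : Type*} [NormedAddCommGroup H] [InnerProductSpace ℂ H] [CompleteSpace H]

/-- A positive self-adjoint operator on a complex Hilbert space: a possibly unbounded operator
`A : D(A) → H` which equals its adjoint (in particular it is densely defined and closed) and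
satisfies `⟨A x, x⟩ ≥ 0` on its domain. -/
structure IsPositiveSelfAdjoint (A : H →ₗ.[ℂ] H) : Prop where
  isSelfAdjoint : IsSelfAdjoint A
  nonneg : ∀ x : A.domain, 0 ≤ (⟪A x, (x : H)⟫_ℂ).re

/-- The kernel `ker A = {x ∈ D(A) | A x = 0}`, as a subspace of `H`. -/
def kernel (A : H →ₗ.[ℂ] H) : Submodule ℂ H :=
  (LinearMap.ker A.toFun).map A.domain.subtype

/-- The space `V = (ker A)^⊥`. -/
abbrev kerPerp (A : H →ₗ.[ℂ] H) : Submodule ℂ H := (kernel A)ᗮ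

variable {A : H →ₗ.[ℂ] H}

theorem IsPositiveSelfAdjoint.norm_le (hA : IsPositiveSelfAdjoint A) (x : A.domain) :
    ‖(x : H)‖ ≤ ‖(x : H) + A x‖ := by
  have h1 : ‖(x : H)‖ ^ 2 ≤ (⟪(x : H) + A x, (x : H)⟫_ℂ).re := by
    rw [inner_add_left, Complex.add_re]
    have h2 := hA.nonneg x
    have h3 : (⟪(x : H), (x : H)⟫_ℂ).re = ‖(x : H)‖ ^ 2 := by
      simpa using inner_self_eq_norm_sq (𝕜 := ℂ) (x : H)
    linarith
  have h4 : (⟪(x : H) + A x, (x : H)⟫_ℂ).re ≤ ‖(x : H) + A x‖ * ‖(x : H)‖ :=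
    (Complex.re_le_norm _).trans (norm_inner_le_norm _ _)
  by_contra! hlt
  have h5 : 0 < ‖(x : H)‖ := (norm_nonneg _).trans_lt hlt
  nlinarith [mul_lt_mul_of_pos_right hlt h5]

/-- The linear map `1 + A` on the domain of `A`. -/
def oneAdd (A : H →ₗ.[ℂ] H) : A.domain →ₗ[ℂ] H := A.domain.subtype + A.toFun

set_option linter.unusedSectionVars false in
theorem oneAdd_apply (x : A.domain) : oneAdd A x = (x : H) + A x := rfl

theorem IsPositiveSelfAdjoint.oneAdd_injective (hA : IsPositiveSelfAdjoint A) :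
    Function.Injective (oneAdd A) := by
  rw [injective_iff_map_eq_zero]
  intro x hx
  have h := hA.norm_le x
  rw [← oneAdd_apply, hx, norm_zero] at h
  exact Subtype.ext (norm_le_zero_iff.mp h)

theorem IsPositiveSelfAdjoint.oneAdd_surjective (hA : IsPositiveSelfAdjoint A) :
    Function.Surjective (oneAdd A) := by
  have hdense := hA.isSelfAdjoint.dense_domain
  -- the range of `1 + A` is closed
  have hclosed : IsClosed (LinearMap.range (oneAdd A) : Set H) := by
    apply isClosed_of_closure_subset
    intro y hy
    obtain ⟨u, hu, hlim⟩ := mem_closure_iff_seq_limit.mp hy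
    choose x hx using hu
    have hcau : CauchySeq fun n => (x n : H) := by
      rw [Metric.cauchySeq_iff']
      intro ε hε
      obtain ⟨N, hN⟩ := Metric.cauchySeq_iff'.mp hlim.cauchySeq ε hε
      refine ⟨N, fun n hn => lt_of_le_of_lt ?_ (hN n hn)⟩
      rw [dist_eq_norm, dist_eq_norm, ← hx n, ← hx N, ← map_sub]
      exact hA.norm_le (x n - x N)
    obtain ⟨z, hz⟩ := cauchySeq_tendsto_of_complete hcau
    have hAz : Filter.Tendsto (fun n => A (x n)) Filter.atTop (nhds (y - z)) := by
      have := hlim.sub hz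
      refine this.congr fun n => ?_
      rw [← hx n, oneAdd_apply, add_sub_cancel_left]
    have hmem : ((z, y - z) : H × H) ∈ A.graph := by
      refine IsClosed.mem_of_tendsto (show IsClosed (A.graph : Set (H × H)) from
        hA.isSelfAdjoint.isClosed) (hz.prodMk_nhds hAz) (Filter.Eventually.of_forall fun n => ?_)
      exact A.mem_graph (x n)
    obtain ⟨w, hw1, hw2⟩ := (LinearPMap.mem_graph_iff A).mp hmem
    refine ⟨w, ?_⟩
    simp only at hw1 hw2
    rw [oneAdd_apply, hw1, hw2]
    abel
  -- the orthogonal complement of the range is trivial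
  have hperp : (LinearMap.range (oneAdd A))ᗮ = ⊥ := by
    rw [Submodule.eq_bot_iff]
    intro z hz
    rw [Submodule.mem_orthogonal'] at hz
    have h1 : ∀ x : A.domain, ⟪-z, (x : H)⟫_ℂ = ⟪z, A x⟫_ℂ := by
      intro x
      have := hz _ ⟨x, rfl⟩
      rw [oneAdd_apply, inner_add_right] at this
      rw [inner_neg_left]
      linear_combination -this
    have hgr : ((z, -z) : H × H) ∈ A.graph := by
      have hAA : A.adjoint = A := hA.isSelfAdjoint
      rw [← hAA, LinearPMap.mem_graph_iff]
      exact ⟨⟨z, LinearPMap.mem_adjoint_domain_of_exists z ⟨-z, h1⟩⟩, rfl,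
        LinearPMap.adjoint_apply_eq hdense _ h1⟩
    obtain ⟨w, hw1, hw2⟩ := (LinearPMap.mem_graph_iff A).mp hgr
    simp only at hw1 hw2
    have h3 : oneAdd A w = 0 := by rw [oneAdd_apply, hw1, hw2, add_neg_cancel]
    have h4 : w = 0 := hA.oneAdd_injective (h3.trans (map_zero _).symm)
    rw [← hw1, h4]
    rfl
  have : CompleteSpace (LinearMap.range (oneAdd A)) := hclosed.completeSpace_coe
  exact LinearMap.range_eq_top.mp (Submodule.orthogonal_eq_bot_iff.mp hperp)

/-- The resolvent `(1 + A)⁻¹`, a bounded everywhere defined operator. -/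
def IsPositiveSelfAdjoint.resolvent (hA : IsPositiveSelfAdjoint A) : H →L[ℂ] H :=
  LinearMap.mkContinuous
    (A.domain.subtype ∘ₗ
      (LinearEquiv.ofBijective (oneAdd A) ⟨hA.oneAdd_injective, hA.oneAdd_surjective⟩).symm)
    1 (fun y => by
      obtain ⟨x, rfl⟩ := hA.oneAdd_surjective y
      have h : (LinearEquiv.ofBijective (oneAdd A)
          ⟨hA.oneAdd_injective, hA.oneAdd_surjective⟩).symm (oneAdd A x) = x :=
        LinearEquiv.symm_apply_apply (LinearEquiv.ofBijective (oneAdd A)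
          ⟨hA.oneAdd_injective, hA.oneAdd_surjective⟩) x
      simp only [LinearMap.comp_apply, LinearEquiv.coe_coe, h, one_mul]
      exact hA.norm_le x)

/-- `(1 + A)⁻¹ (x + A x) = x` for `x ∈ D(A)`. -/
theorem IsPositiveSelfAdjoint.resolvent_add (hA : IsPositiveSelfAdjoint A) (x : A.domain) :
    hA.resolvent ((x : H) + A x) = x := by
  have h : (LinearEquiv.ofBijective (oneAdd A)
      ⟨hA.oneAdd_injective, hA.oneAdd_surjective⟩).symm (oneAdd A x) = x :=
    LinearEquiv.symm_apply_apply (LinearEquiv.ofBijective (oneAdd A)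
      ⟨hA.oneAdd_injective, hA.oneAdd_surjective⟩) x
  exact congrArg Subtype.val h

theorem IsPositiveSelfAdjoint.isSelfAdjoint_resolvent (hA : IsPositiveSelfAdjoint A) :
    IsSelfAdjoint hA.resolvent := by
  rw [ContinuousLinearMap.isSelfAdjoint_iff_isSymmetric]
  intro f g
  obtain ⟨x, rfl⟩ := hA.oneAdd_surjective f
  obtain ⟨y, rfl⟩ := hA.oneAdd_surjective g
  have hsymm : ⟪A x, (y : H)⟫_ℂ = ⟪(x : H), A y⟫_ℂ := by
    have h := LinearPMap.adjoint_isFormalAdjoint hA.isSelfAdjoint.dense_domain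
    rw [show A.adjoint = A from hA.isSelfAdjoint] at h
    exact h x y
  simp only [oneAdd_apply, ContinuousLinearMap.coe_coe, hA.resolvent_add, inner_add_left,
    inner_add_right, hsymm]

/-- Let `r = (1 + s)⁻¹`, so that `s = r⁻¹ - 1`. A function `φ` of the spectral variable `s ≥ 0` of
`A`, vanishing at infinity, becomes the following function of the spectral variable `r ∈ [0, 1]` of
the resolvent `(1 + A)⁻¹` (the value `r = 0` corresponds to `s = ∞`). -/
def pullback (φ : ℝ → ℝ) (r : ℝ) : ℝ := if r ≤ 0 then 0 else φ (r⁻¹ - 1)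

/-- The functional calculus `φ(A)` of the positive self-adjoint operator `A`, for a function `φ`
continuous on `[0, ∞)` and vanishing at infinity, by means of Mathlib's continuous functional
calculus of the bounded self-adjoint operator `(1 + A)⁻¹`. -/
def IsPositiveSelfAdjoint.functionalCalculus (hA : IsPositiveSelfAdjoint A) (φ : ℝ → ℝ) :
    H →L[ℂ] H :=
  cfc (pullback φ) hA.resolvent

/-- The heat operator `e^{-tA}`, for `t > 0`. -/
def IsPositiveSelfAdjoint.heat (hA : IsPositiveSelfAdjoint A) (t : ℝ) : H →L[ℂ] H :=
  hA.functionalCalculus fun s => Real.exp (-t * s)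

theorem continuous_pullback (φ : C_c(ℝ, ℝ)) : Continuous (pullback φ) := by
  obtain ⟨C, hC⟩ := φ.hasCompactSupport.isCompact.bddAbove
  have hzero : ∀ s, C < s → φ s = 0 := fun s hs => by
    by_contra h
    exact absurd (hC (subset_tsupport _ h)) (not_le.mpr hs)
  set K : ℝ := max C 0 with hK
  have hK0 : 0 ≤ K := le_max_right _ _
  -- near `r = 0` the function vanishes
  have heq : pullback φ = fun r => φ ((max r (K + 2)⁻¹)⁻¹ - 1) := by
    funext r
    have hp : (0 : ℝ) < (K + 2)⁻¹ := by positivity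
    rcases le_or_gt (K + 2)⁻¹ r with h | h
    · rw [max_eq_left h, pullback, if_neg (not_le.mpr (hp.trans_le h))]
    · have h0 : φ ((K + 2)⁻¹⁻¹ - 1) = 0 := by
        apply hzero
        rw [inv_inv]
        linarith [le_max_left C 0]
      rw [max_eq_right h.le, h0, pullback]
      split_ifs with hr
      · rfl
      · apply hzero
        have : K + 2 < r⁻¹ := (lt_inv_comm₀ (not_le.mp hr) (by positivity)).mp h
        linarith [le_max_left C 0]
  rw [heq]
  refine φ.continuous.comp (Continuous.sub (Continuous.inv₀ (by fun_prop) fun r => ?_)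
    continuous_const)
  have hp : (0 : ℝ) < (K + 2)⁻¹ := by positivity
  exact (hp.trans_le (le_max_right _ _)).ne'

/-- The positive linear functional `φ ↦ ⟨φ(A) f, f⟩` on compactly supported continuous functions
of the spectral variable. -/
def IsPositiveSelfAdjoint.spectralFunctional (hA : IsPositiveSelfAdjoint A) (f : H) :
    C_c(ℝ, ℝ) →ₚ[ℝ] ℝ :=
  PositiveLinearMap.mk₀
    { toFun := fun φ => (⟪hA.functionalCalculus φ f, f⟫_ℂ).re
      map_add' := fun φ ψ => by
        have h : pullback (φ + ψ : C_c(ℝ, ℝ)) = fun r => pullback φ r + pullback ψ r := by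
          funext r
          simp only [pullback]
          split_ifs <;> simp
        simp only [functionalCalculus]
        rw [h, cfc_add _ _ _ (continuous_pullback φ).continuousOn
          (continuous_pullback ψ).continuousOn, add_apply, inner_add_left,
          Complex.add_re]
      map_smul' := fun c φ => by
        have h : pullback (c • φ : C_c(ℝ, ℝ)) = fun r => c • pullback φ r := by
          funext r
          simp only [pullback]
          split_ifs <;> simp
        simp only [functionalCalculus]
        rw [h, cfc_smul c _ _ (continuous_pullback φ).continuousOn, smul_apply,
          inner_smul_left_eq_smul, Complex.smul_re, RingHom.id_apply] }
    (fun φ hφ => by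
      have h : 0 ≤ hA.functionalCalculus φ := by
        apply cfc_nonneg
        intro r _
        simp only [pullback]
        split_ifs
        · exact le_rfl
        · exact hφ _
      exact ((ContinuousLinearMap.nonneg_iff_isPositive _).mp h).re_inner_nonneg_left f)

/-- The spectral measure `d⟨Π_s f, f⟩` of the vector `f` with respect to `A`: the Borel measure on
`ℝ` (carried by `[0, ∞)`) such that `⟨φ(A) f, f⟩ = ∫ φ(s) d⟨Π_s f, f⟩` for all compactly supported
continuous `φ`. -/
def IsPositiveSelfAdjoint.spectralMeasure (hA : IsPositiveSelfAdjoint A) (f : H) : Measure ℝ :=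
  RealRMK.rieszMeasure (hA.spectralFunctional f)

/-- The energy `ℰ(f) = ⟨A f, f⟩ = ∫ s d⟨Π_s f, f⟩ ∈ [0, ∞]`, defined for every `f ∈ H`. It is finite
exactly on the form domain `D(A^{1/2})`. -/
def IsPositiveSelfAdjoint.energy (hA : IsPositiveSelfAdjoint A) (f : H) : ℝ≥0∞ :=
  ∫⁻ s, ENNReal.ofReal s ∂(hA.spectralMeasure f)

end Abstract

section Concrete

variable {X : Type*} [MeasurableSpace X] {μ : Measure X}

/-- The ultracontractive norm `‖P‖_{1,∞}`: the norm, in `[0, ∞]`, of the bounded operator `P` of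
`L²(μ)` as a map from `L¹ ∩ L²`, with the `L¹` norm, to `L^∞`. -/
def ultraNorm (P : Lp ℂ 2 μ →L[ℂ] Lp ℂ 2 μ) : ℝ≥0∞ :=
  ⨆ (g : Lp ℂ 2 μ) (_ : eLpNorm g 1 μ ≤ 1), eLpNorm (P g) ∞ μ

variable {A : Lp ℂ 2 μ →ₗ.[ℂ] Lp ℂ 2 μ}

/-- `L(t) = ‖e^{-tA} Π_V‖_{1,∞}`, where `Π_V` is the orthogonal projection onto `V = (ker A)^⊥`. -/
def heatDecay (hA : IsPositiveSelfAdjoint A) (t : ℝ) : ℝ≥0∞ :=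
  ultraNorm (hA.heat t ∘L (kerPerp A).starProjection)

/-- `M(t) = ∫_t^∞ L(u) du`. -/
def heatTail (hA : IsPositiveSelfAdjoint A) (t : ℝ) : ℝ≥0∞ :=
  ∫⁻ u in Set.Ioi t, heatDecay hA u

end Concrete

/-- The right continuous inverse `M⁻¹(y) = inf {t > 0 | M(t) ≤ y}` of a nonincreasing function on
`(0, ∞)`, with `inf ∅ = ∞`. -/
def decreasingInverse (M : ℝ → ℝ≥0∞) (y : ℝ≥0∞) : ℝ≥0∞ :=
  ⨅ (t : ℝ) (_ : 0 < t) (_ : M t ≤ y), ENNReal.ofReal t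

/-- `N(y) = y / M⁻¹(y)`, with `y / 0 = ∞` for `y > 0` and `N(0) = 0`. -/
def orliczN (M : ℝ → ℝ≥0∞) (y : ℝ≥0∞) : ℝ≥0∞ := y / decreasingInverse M y

end HeatSobolev

end

noncomputable section

namespace HeatSobolev

/-! Write E for the energy of f. Factoring e^{-tA} = A^{1/2} · A^{-1/2}e^{-tA} on V, Cauchy–Schwarz
and A^{-1}e^{-2tA} = ∫_{2t}^∞ e^{-uA} du bound the pairing of e^{-tA}f with g, ‖g‖₁ ≤ 1, by (E ·
M(2t))^{1/2}; L¹–L^∞ duality makes this a sup bound (`ae_enorm_heat_sq_le`). Hence where |f|² ≥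
4E·M(2t), the smoothed e^{-tA}f is at most half of f, and |f| ≤ 2|f - e^{-tA}f|
(`setLIntegral_enorm_sq_le_sub_heat`).

Integrate this against dt/t². By the spectral theorem and the scalar integral
`lintegral_one_sub_exp_sq`, the right side is at most 4 · 2 ln 2 · E. On the left, Tonelli leaves
|f|² times the dt/t²-mass of {t : M(2t) ≤ |f|²/4E}, which is at least 2/M⁻¹(|f|²/4E)
(`inv_decreasingInverse_le`). Dividing by 8E gives the claim.

All spectral arguments run through the resolvent, with r = 1/(1+s) in [0,1]; A^{±1/2} is replaced by
square roots of a bounded positive regularization of s, removed in the limit. -/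

/-- The functions `s ↦ max 0 (min s (n - s))`, increasing to the positive part of `s`. -/
def tent (n : ℕ) : C_c(ℝ, ℝ) where
  toFun s := max 0 (min s (n - s))
  continuous_toFun := by fun_prop
  hasCompactSupport' := HasCompactSupport.intro (isCompact_Icc (a := (0 : ℝ)) (b := n))
    fun s hs => by
      rw [Set.mem_Icc, not_and_or, not_le, not_le] at hs
      rcases hs with hs | hs
      · exact max_eq_left ((min_le_left _ _).trans hs.le)
      · exact max_eq_left ((min_le_right _ _).trans (by linarith))

theorem tent_apply (n : ℕ) (s : ℝ) : tent n s = max 0 (min s (n - s)) := rfl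

/-! ### Spectral measures of a bounded self-adjoint operator. -/

section Bounded

variable {H : Type*} [NormedAddCommGroup H] [InnerProductSpace ℂ H] [CompleteSpace H]

/-- The positive functional `φ ↦ ⟨φ(T) f, f⟩` on functions on the spectrum of a bounded
self-adjoint operator `T`. -/
def vectorFunctional {T : H →L[ℂ] H} (hT : IsSelfAdjoint T) (f : H) :
    C_c(spectrum ℝ T, ℝ) →ₚ[ℝ] ℝ :=
  PositiveLinearMap.mk₀
    { toFun := fun φ => (⟪cfcHom (R := ℝ) hT φ.toContinuousMap f, f⟫_ℂ).re
      map_add' := fun φ ψ => by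
        have h : (φ + ψ).toContinuousMap = φ.toContinuousMap + ψ.toContinuousMap := rfl
        rw [h, map_add, add_apply, inner_add_left, Complex.add_re]
      map_smul' := fun c φ => by
        have h : (c • φ).toContinuousMap = c • φ.toContinuousMap := rfl
        rw [h, map_smul, smul_apply, inner_smul_left_eq_smul, Complex.smul_re, RingHom.id_apply] }
    (fun φ hφ => by
      have h : 0 ≤ cfcHom (R := ℝ) hT φ.toContinuousMap := (cfcHom_nonneg_iff hT).mpr hφ
      exact ((ContinuousLinearMap.nonneg_iff_isPositive _).mp h).re_inner_nonneg_left f)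

/-- The spectral measure of the vector `f` with respect to a bounded self-adjoint operator. -/
def vectorMeasure {T : H →L[ℂ] H} (hT : IsSelfAdjoint T) (f : H) : Measure (spectrum ℝ T) :=
  RealRMK.rieszMeasure (vectorFunctional hT f)

instance {T : H →L[ℂ] H} (hT : IsSelfAdjoint T) (f : H) :
    IsFiniteMeasure (vectorMeasure hT f) := by
  unfold vectorMeasure
  infer_instance

variable {T : H →L[ℂ] H} (hT : IsSelfAdjoint T)

theorem integral_vectorMeasure (f : H) {g : ℝ → ℝ} (hg : ContinuousOn g (spectrum ℝ T)) :
    ∫ x, g x ∂(vectorMeasure hT f) = (⟪cfc g T f, f⟫_ℂ).re := by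
  have h := RealRMK.integral_rieszMeasure (vectorFunctional hT f)
    (CompactlySupportedContinuousMap.continuousMapEquiv ⟨_, hg.domRestrict⟩)
  rw [cfc_apply g T hT hg]
  exact h

theorem lintegral_vectorMeasure (f : H) {g : ℝ → ℝ} (hg : ContinuousOn g (spectrum ℝ T))
    (hg0 : ∀ x ∈ spectrum ℝ T, 0 ≤ g x) :
    ∫⁻ x, ENNReal.ofReal (g x) ∂(vectorMeasure hT f) =
      ENNReal.ofReal (⟪cfc g T f, f⟫_ℂ).re := by
  rw [← integral_vectorMeasure hT f hg, ofReal_integral_eq_lintegral_ofReal]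
  · exact (BoundedContinuousFunction.mkOfCompact
      (⟨_, hg.domRestrict⟩ : C(spectrum ℝ T, ℝ))).integrable _
  · exact Filter.Eventually.of_forall fun x => hg0 x x.2

theorem inner_cfc_left (g : ℝ → ℝ) (f k : H) : ⟪cfc g T f, k⟫_ℂ = ⟪f, cfc g T k⟫_ℂ := by
  have h : IsSelfAdjoint (cfc g T) := IsSelfAdjoint.cfc
  rw [ContinuousLinearMap.isSelfAdjoint_iff_isSymmetric] at h
  exact h f k

theorem cfc_mul_apply {g k : ℝ → ℝ} (hg : ContinuousOn g (spectrum ℝ T))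
    (hk : ContinuousOn k (spectrum ℝ T)) (f : H) :
    cfc (fun x => g x * k x) T f = cfc g T (cfc k T f) := by
  rw [cfc_mul g k T hg hk]
  rfl

/-- One factor g(T) moves across the inner product by self-adjointness. Through this identity norm
estimates become integrals of scalar functions. -/
theorem enorm_cfc_sq (f : H) {g : ℝ → ℝ} (hg : ContinuousOn g (spectrum ℝ T)) :
    ‖cfc g T f‖ₑ ^ 2 = ∫⁻ x, ENNReal.ofReal (g x ^ 2) ∂(vectorMeasure hT f) := by
  rw [lintegral_vectorMeasure hT f (g := fun x => g x ^ 2) (hg.pow 2) (fun x _ => sq_nonneg _)]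
  have h : cfc (fun x => g x ^ 2) T f = cfc g T (cfc g T f) := by
    rw [← cfc_mul_apply hg hg]
    simp only [sq]
  rw [h, inner_cfc_left, ← ofReal_norm, ← ENNReal.ofReal_pow (norm_nonneg _)]
  congr 1
  simpa using (inner_self_eq_norm_sq (𝕜 := ℂ) (cfc g T f)).symm

theorem vectorMeasure_univ (f : H) : vectorMeasure hT f Set.univ = ‖f‖ₑ ^ 2 := by
  have h := enorm_cfc_sq hT f (g := fun _ => 1) continuousOn_const
  have h1 : cfc (fun _ : ℝ => (1 : ℝ)) T = 1 := cfc_const_one ℝ T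
  rw [h1] at h
  simpa using h.symm

/-- If `T` has dense range, then its spectral measures do not charge `0`. -/
theorem vectorMeasure_ae_ne_zero (hT0 : ∀ x ∈ spectrum ℝ T, 0 ≤ x) (hd : DenseRange T) (f : H) :
    ∀ᵐ x : spectrum ℝ T ∂(vectorMeasure hT f), (x : ℝ) ≠ 0 := by
  set S : Set (spectrum ℝ T) := {x | (x : ℝ) = 0} with hS
  have hSm : MeasurableSet S := measurable_subtype_coe (measurableSet_singleton (0 : ℝ))
  -- The function c/(c+x) equals 1 at x = 0, so it dominates the mass there; but c/(c+T) has norm at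
  -- most 1 and sends Tk to a vector of norm at most c‖k‖.
  have hcont (c : ℝ) (hc : 0 < c) : ContinuousOn (fun x : ℝ => c / (c + x)) (spectrum ℝ T) :=
    continuousOn_const.div (by fun_prop) fun x hx => by have := hT0 x hx; positivity
  have hbd (c : ℝ) (hc : 0 < c) : vectorMeasure hT f S ≤ ‖cfc (fun x => c / (c + x)) T f‖ₑ ^ 2 := by
    rw [enorm_cfc_sq hT f (hcont c hc), ← lintegral_indicator_one hSm]
    refine lintegral_mono fun x => ?_
    by_cases hx : x ∈ S
    · have hx' : (x : ℝ) = 0 := hx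
      simp [hx, hx', hc.ne']
    · simp [hx]
  have hle (ε : ℝ) (hε : 0 < ε) : vectorMeasure hT f S ≤ ENNReal.ofReal (ε ^ 2) := by
    obtain ⟨k, hk⟩ := hd.exists_dist_lt f (half_pos hε)
    -- Chosen so that c‖k‖ ≤ ε/2; the +1 covers k = 0.
    set c : ℝ := ε / (2 * (‖k‖ + 1)) with hc
    have hkp : 0 < ‖k‖ + 1 := by positivity
    have hcp : 0 < c := by positivity
    refine (hbd c hcp).trans ?_
    rw [← ofReal_norm, ← ENNReal.ofReal_pow (norm_nonneg _)]
    refine ENNReal.ofReal_le_ofReal (pow_le_pow_left₀ (norm_nonneg _) ?_ 2)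
    have h1 : ‖cfc (fun x => c / (c + x)) T‖ ≤ 1 := by
      refine norm_cfc_le zero_le_one fun x hx => ?_
      have := hT0 x hx
      rw [Real.norm_of_nonneg (by positivity), div_le_one (by positivity)]
      linarith
    have h2 : cfc (fun x => c / (c + x)) T (T k) = cfc (fun x => c / (c + x) * x) T k := by
      rw [cfc_mul_apply (hcont c hcp) (continuousOn_id' _), cfc_id' ℝ T]
    have h3 : ‖cfc (fun x => c / (c + x) * x) T‖ ≤ c := by
      refine norm_cfc_le hcp.le fun x hx => ?_
      have := hT0 x hx
      rw [Real.norm_of_nonneg (by positivity), div_mul_eq_mul_div, div_le_iff₀ (by positivity)]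
      nlinarith
    calc ‖cfc (fun x => c / (c + x)) T f‖
        = ‖cfc (fun x => c / (c + x)) T (f - T k) + cfc (fun x => c / (c + x) * x) T k‖ := by
          rw [← h2, ← map_add, sub_add_cancel]
      _ ≤ 1 * (ε / 2) + c * ‖k‖ := by
          refine (norm_add_le _ _).trans (add_le_add ?_ ?_)
          · refine (ContinuousLinearMap.le_opNorm _ _).trans ?_
            rw [dist_eq_norm] at hk
            exact mul_le_mul h1 hk.le (norm_nonneg _) zero_le_one
          · exact ContinuousLinearMap.le_of_opNorm_le _ h3 _
      _ ≤ ε := by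
          have : c * (‖k‖ + 1) = ε / 2 := by rw [hc]; field_simp
          nlinarith
  have hzero : vectorMeasure hT f S = 0 := by
    refine le_antisymm (ENNReal.le_of_forall_pos_le_add fun ε hε _ => ?_) zero_le
    have := hle (Real.sqrt ε) (Real.sqrt_pos.mpr hε)
    rwa [Real.sq_sqrt ε.coe_nonneg, ENNReal.ofReal_coe_nnreal, ← zero_add (ε : ℝ≥0∞)] at this
  rw [ae_iff]
  simpa [hS] using hzero

end Bounded

/-! ### The resolvent: spectrum in [0,1], and comparison with the energy. -/

section Resolvent

variable {H : Type*} [NormedAddCommGroup H] [InnerProductSpace ℂ H] [CompleteSpace H]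
  {A : H →ₗ.[ℂ] H} (hA : IsPositiveSelfAdjoint A)

include hA

theorem IsPositiveSelfAdjoint.resolvent_nonneg : 0 ≤ hA.resolvent := by
  rw [ContinuousLinearMap.nonneg_iff_isPositive, ContinuousLinearMap.isPositive_def']
  refine ⟨hA.isSelfAdjoint_resolvent, fun y => ?_⟩
  obtain ⟨x, rfl⟩ := hA.oneAdd_surjective y
  have h1 : (⟪(x : H), (x : H)⟫_ℂ).re = ‖(x : H)‖ ^ 2 := by
    simpa using inner_self_eq_norm_sq (𝕜 := ℂ) (x : H)
  have h2 : (⟪(x : H), A x⟫_ℂ).re = (⟪A x, (x : H)⟫_ℂ).re := inner_re_symm (𝕜 := ℂ) _ _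
  rw [ContinuousLinearMap.reApplyInnerSelf_apply, oneAdd_apply, hA.resolvent_add, inner_add_right]
  change 0 ≤ (⟪(x : H), (x : H)⟫_ℂ + ⟪(x : H), A x⟫_ℂ).re
  rw [Complex.add_re, h1, h2]
  exact add_nonneg (sq_nonneg _) (hA.nonneg x)

theorem IsPositiveSelfAdjoint.norm_resolvent_le : ‖hA.resolvent‖ ≤ 1 :=
  LinearMap.mkContinuous_norm_le _ zero_le_one _

theorem IsPositiveSelfAdjoint.nonneg_of_mem_spectrum {r : ℝ}
    (hr : r ∈ spectrum ℝ hA.resolvent) : 0 ≤ r :=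
  spectrum_nonneg_of_nonneg hA.resolvent_nonneg hr

theorem IsPositiveSelfAdjoint.le_one_of_mem_spectrum {r : ℝ}
    (hr : r ∈ spectrum ℝ hA.resolvent) : r ≤ 1 := by
  have h := spectrum.norm_le_norm_mul_of_mem hr
  have h1 : ‖(1 : H →L[ℂ] H)‖ ≤ 1 := ContinuousLinearMap.norm_id_le
  have h2 := hA.norm_resolvent_le
  have h3 := Real.le_norm_self r
  nlinarith [norm_nonneg (1 : H →L[ℂ] H), norm_nonneg hA.resolvent]

theorem IsPositiveSelfAdjoint.denseRange_resolvent : DenseRange hA.resolvent := by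
  refine hA.isSelfAdjoint.dense_domain.mono fun x hx => ?_
  exact ⟨_, hA.resolvent_add ⟨x, hx⟩⟩

/-- The spectral measure of `f` with respect to the resolvent. -/
abbrev IsPositiveSelfAdjoint.resolventMeasure (f : H) : Measure (spectrum ℝ hA.resolvent) :=
  vectorMeasure hA.isSelfAdjoint_resolvent f

/-- The point r = 0 stands for s = ∞; it carries no mass because the range of the resolvent is D(A),
which is dense. -/
theorem IsPositiveSelfAdjoint.ae_pos_resolventMeasure (f : H) :
    ∀ᵐ r : spectrum ℝ hA.resolvent ∂(hA.resolventMeasure f), 0 < (r : ℝ) := by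
  filter_upwards [vectorMeasure_ae_ne_zero hA.isSelfAdjoint_resolvent
    (fun x hx => hA.nonneg_of_mem_spectrum hx) hA.denseRange_resolvent f] with r hr
  exact (hA.nonneg_of_mem_spectrum r.2).lt_of_ne' hr

/-- Both measures represent ⟨φ(A)f, f⟩ for compactly supported φ. Testing with the tents and
monotone convergence compares the two integrals of s; only this direction is needed. -/
theorem IsPositiveSelfAdjoint.lintegral_resolventMeasure_le_energy (f : H) :
    ∫⁻ r, ENNReal.ofReal (pullback id r) ∂(hA.resolventMeasure f) ≤ hA.energy f := by
  have h1 (n : ℕ) : ∫⁻ r, ENNReal.ofReal (pullback (tent n) r) ∂(hA.resolventMeasure f) ≤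
      hA.energy f := by
    rw [lintegral_vectorMeasure _ f (continuous_pullback _).continuousOn]
    · have h2 := RealRMK.integral_rieszMeasure (hA.spectralFunctional f) (tent n)
      have h3 : hA.spectralFunctional f (tent n) =
        (⟪cfc (pullback (tent n)) hA.resolvent f, f⟫_ℂ).re := rfl
      rw [← h3, ← h2, ofReal_integral_eq_lintegral_ofReal]
      · refine lintegral_mono fun s => ?_
        rw [tent_apply, ENNReal.ofReal_max, ENNReal.ofReal_zero]
        exact max_le zero_le (ENNReal.ofReal_le_ofReal (min_le_left _ _))
      · exact (tent n).continuous.integrable_of_hasCompactSupport (tent n).hasCompactSupport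
      · exact Filter.Eventually.of_forall fun s => le_max_left _ _
    · intro r _
      unfold pullback
      split_ifs
      · exact le_rfl
      · exact le_max_left _ _
  have h4 : ∀ r : spectrum ℝ hA.resolvent, ENNReal.ofReal (pullback id r) =
      ⨆ n : ℕ, ENNReal.ofReal (pullback (tent n) r) := by
    intro r
    refine le_antisymm ?_ (iSup_le fun n => ENNReal.ofReal_le_ofReal ?_)
    -- For n ≥ 2s one has s ≤ n - s, so the tent already equals s there.
    · obtain ⟨n, hn⟩ := exists_nat_ge (2 * ((r : ℝ)⁻¹ - 1))
      refine le_iSup_of_le n (ENNReal.ofReal_le_ofReal ?_)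
      unfold pullback
      split_ifs
      · exact le_rfl
      · rw [tent_apply, id]
        exact le_max_of_le_right (le_min le_rfl (by linarith))
    · unfold pullback
      split_ifs with h
      · exact le_rfl
      · rw [tent_apply, id]
        refine max_le ?_ (min_le_left _ _)
        have := (one_le_inv₀ (not_le.mp h)).mpr (hA.le_one_of_mem_spectrum r.2)
        linarith
  simp only [h4]
  rw [lintegral_iSup]
  · exact iSup_le h1
  · intro n
    exact ((continuous_pullback _).comp continuous_subtype_val).measurable.ennreal_ofReal
  · intro n m hnm r
    refine ENNReal.ofReal_le_ofReal ?_
    unfold pullback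
    split_ifs
    · exact le_rfl
    · simp only [tent_apply]
      have : (n : ℝ) ≤ m := by exact_mod_cast hnm
      gcongr

end Resolvent

/-! ### The scalar integral that produces ln 2. -/

section Scalar

theorem lintegral_Ioi_exp_neg_mul {c : ℝ} (hc : 0 < c) (a : ℝ) :
    ∫⁻ u in Set.Ioi a, ENNReal.ofReal (Real.exp (-u * c)) =
      ENNReal.ofReal (Real.exp (-a * c) / c) := by
  have h := integral_exp_mul_Ioi (neg_lt_zero.mpr hc) a
  have hi := integrableOn_exp_mul_Ioi (neg_lt_zero.mpr hc) a
  have he : ∀ u : ℝ, -u * c = -c * u := fun u => by ring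
  simp only [he]
  rw [← ofReal_integral_eq_lintegral_ofReal hi
    (Filter.Eventually.of_forall fun _ => (Real.exp_pos _).le), h]
  congr 1
  rw [neg_div_neg_eq]

theorem lintegral_Ioc_exp_neg_mul {t s : ℝ} (ht : 0 < t) (hs : 0 ≤ s) :
    ∫⁻ u in Set.Ioc 0 s, ENNReal.ofReal (Real.exp (-t * u)) =
      ENNReal.ofReal ((1 - Real.exp (-t * s)) / t) := by
  have hc : Continuous fun u : ℝ => Real.exp (-t * u) := by fun_prop
  rw [← ofReal_integral_eq_lintegral_ofReal (hc.integrableOn_Ioc)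
    (Filter.Eventually.of_forall fun _ => (Real.exp_pos _).le),
    ← intervalIntegral.integral_of_le hs]
  congr 1
  have hd : ∀ x ∈ Set.uIcc 0 s,
      HasDerivAt (fun u => -Real.exp (-t * u) / t) (Real.exp (-t * x)) x := by
    intro x _
    have h := (((hasDerivAt_id x).const_mul (-t)).exp.neg).div_const t
    refine h.congr_deriv ?_
    rw [mul_one, mul_neg, neg_neg, mul_div_cancel_right₀ _ ht.ne']
    rfl
  rw [intervalIntegral.integral_eq_sub_of_hasDerivAt hd (hc.intervalIntegrable _ _)]
  simp only [mul_zero, Real.exp_zero]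
  ring

theorem lintegral_Ioc_inv_add {u s : ℝ} (hu : 0 < u) (hs : 0 ≤ s) :
    ∫⁻ v in Set.Ioc 0 s, ENNReal.ofReal (u + v)⁻¹ =
      ENNReal.ofReal (Real.log (u + s) - Real.log u) := by
  have hc : ContinuousOn (fun v : ℝ => (u + v)⁻¹) (Set.Icc 0 s) :=
    ContinuousOn.inv₀ (by fun_prop) fun v hv => by have := hv.1; positivity
  rw [← ofReal_integral_eq_lintegral_ofReal (hc.integrableOn_Icc.mono_set Set.Ioc_subset_Icc_self),
    ← intervalIntegral.integral_of_le hs,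
    intervalIntegral.integral_comp_add_left (fun v => v⁻¹), add_zero,
    integral_inv_of_pos hu (by positivity), Real.log_div (by positivity) hu.ne']
  filter_upwards [ae_restrict_mem measurableSet_Ioc] with v hv
  have := hv.1
  simp only [Pi.zero_apply]
  positivity

/-- With the primitive x log x - x, the linear terms cancel and 2s log(2s) - 2s log s remains. -/
theorem lintegral_Ioc_log_sub {s : ℝ} (hs : 0 < s) :
    ∫⁻ u in Set.Ioc 0 s, ENNReal.ofReal (Real.log (u + s) - Real.log u) =
      ENNReal.ofReal (2 * Real.log 2 * s) := by
  have h1 : IntervalIntegrable (fun u => Real.log (u + s)) volume 0 s := by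
    apply ContinuousOn.intervalIntegrable
    refine ContinuousOn.log (by fun_prop) fun u hu => ?_
    rw [Set.uIcc_of_le hs.le] at hu
    have := hu.1
    positivity
  have h2 : IntervalIntegrable Real.log volume 0 s := intervalIntegral.intervalIntegrable_log'
  rw [← ofReal_integral_eq_lintegral_ofReal
      ((intervalIntegrable_iff_integrableOn_Ioc_of_le hs.le).mp (h1.sub h2)),
    ← intervalIntegral.integral_of_le hs.le, intervalIntegral.integral_sub h1 h2,
    intervalIntegral.integral_comp_add_right, integral_log, integral_log]
  · congr 1
    rw [show s + s = 2 * s by ring, Real.log_mul two_ne_zero hs.ne']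
    simp
    ring
  · filter_upwards [ae_restrict_mem measurableSet_Ioc] with u hu
    exact sub_nonneg.mpr (Real.log_le_log hu.1 (by linarith))

/-- `∫₀^∞ (1 - e^{-ts})² t⁻² dt = 2 s ln 2`. -/
theorem lintegral_one_sub_exp_sq {s : ℝ} (hs : 0 ≤ s) :
    ∫⁻ t in Set.Ioi 0, ENNReal.ofReal ((t ^ 2)⁻¹ * (1 - Real.exp (-t * s)) ^ 2) =
      ENNReal.ofReal (2 * Real.log 2 * s) := by
  rcases hs.eq_or_lt with rfl | hs
  · simp
  -- Since (1 - e^{-ts})/t = ∫₀^s e^{-tu} du, its square is a double integral over u and v.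
  -- Integrating in t first leaves ∫∫ 1/(u+v) over the square.
  have h1 : ∀ t ∈ Set.Ioi (0 : ℝ), ENNReal.ofReal ((t ^ 2)⁻¹ * (1 - Real.exp (-t * s)) ^ 2) =
      ∫⁻ u in Set.Ioc 0 s, ∫⁻ v in Set.Ioc 0 s, ENNReal.ofReal (Real.exp (-t * (u + v))) := by
    intro t ht
    have ht : 0 < t := ht
    have h2 : (t ^ 2)⁻¹ * (1 - Real.exp (-t * s)) ^ 2 =
        (1 - Real.exp (-t * s)) / t * ((1 - Real.exp (-t * s)) / t) := by
      field_simp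
    have h3 : 0 ≤ (1 - Real.exp (-t * s)) / t := by
      refine div_nonneg (sub_nonneg.mpr (Real.exp_le_one_iff.mpr ?_)) ht.le
      nlinarith
    rw [h2, ENNReal.ofReal_mul h3, ← lintegral_Ioc_exp_neg_mul ht hs.le,
      ← lintegral_mul_const _ (by fun_prop)]
    refine lintegral_congr fun u => ?_
    rw [← lintegral_const_mul _ (by fun_prop)]
    refine lintegral_congr fun v => ?_
    rw [← ENNReal.ofReal_mul (Real.exp_pos _).le, ← Real.exp_add, mul_add]
  rw [setLIntegral_congr_fun measurableSet_Ioi h1, lintegral_lintegral_swap]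
  · rw [← lintegral_Ioc_log_sub hs]
    refine setLIntegral_congr_fun measurableSet_Ioc fun u hu => ?_
    rw [lintegral_lintegral_swap (by fun_prop), ← lintegral_Ioc_inv_add hu.1 hs.le]
    refine setLIntegral_congr_fun measurableSet_Ioc fun v hv => ?_
    rw [lintegral_Ioi_exp_neg_mul (add_pos hu.1 hv.1)]
    simp
  · apply Measurable.aemeasurable
    apply Measurable.lintegral_prod_right' (f := fun p : (ℝ × ℝ) × ℝ =>
      ENNReal.ofReal (Real.exp (-p.1.1 * (p.1.2 + p.2))))
    fun_prop

end Scalar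

/-! ### Heat and regularized energy as functions of r. -/

section HeatFunction

/-- The heat operator `e^{-tA}` as a function of the resolvent. -/
def heatFun (t r : ℝ) : ℝ := pullback (fun s => Real.exp (-t * s)) r

theorem heatFun_of_pos {t r : ℝ} (hr : 0 < r) : heatFun t r = Real.exp (-t * (r⁻¹ - 1)) :=
  if_neg (not_le.mpr hr)

theorem heatFun_of_nonpos {t r : ℝ} (hr : r ≤ 0) : heatFun t r = 0 := if_pos hr

theorem heatFun_nonneg (t r : ℝ) : 0 ≤ heatFun t r := by
  rcases le_or_gt r 0 with hr | hr
  · rw [heatFun_of_nonpos hr]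
  · rw [heatFun_of_pos hr]
    positivity

theorem heatFun_sq (t r : ℝ) : heatFun t r ^ 2 = heatFun (2 * t) r := by
  rcases le_or_gt r 0 with hr | hr
  · simp [heatFun_of_nonpos hr]
  · rw [heatFun_of_pos hr, heatFun_of_pos hr, ← Real.exp_nat_mul]
    congr 1
    push_cast
    ring

/-- Up to the factor e^t this is the flat function e^{-1/x} at x = r/t, hence continuous across r =
0. -/
theorem continuous_heatFun {t : ℝ} (ht : 0 < t) : Continuous (heatFun t) := by
  have h : heatFun t = fun r => Real.exp t * expNegInvGlue (r / t) := by
    funext r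
    rcases le_or_gt r 0 with hr | hr
    · rw [heatFun_of_nonpos hr, expNegInvGlue.zero_of_nonpos (div_nonpos_of_nonpos_of_nonneg hr ht.le),
        mul_zero]
    · rw [heatFun_of_pos hr, expNegInvGlue, if_neg (not_le.mpr (by positivity)), ← Real.exp_add,
        inv_div]
      congr 1
      ring
  rw [h]
  have := (expNegInvGlue.contDiff (n := 0)).continuous
  fun_prop

theorem measurable_heatFun : Measurable fun p : ℝ × ℝ => heatFun p.1 p.2 :=
  Measurable.ite (measurableSet_le measurable_snd measurable_const) measurable_const (by fun_prop)

/-- The function `s / (1 + δ s) + ε` of `s = r⁻¹ - 1`. -/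
def regularizer (δ ε r : ℝ) : ℝ := (1 - r) / (r + δ * (1 - r)) + ε

variable {δ ε r : ℝ}

/-- The term ε matters at r = 1, that is s = 0, where the quotient vanishes; it allows division by
the square root. -/
theorem regularizer_pos (hδ : 0 < δ) (hε : 0 < ε) (hr : r ∈ Set.Icc (0 : ℝ) 1) :
    0 < regularizer δ ε r := by
  have h1 := hr.1
  have h2 := sub_nonneg.mpr hr.2
  unfold regularizer
  positivity

theorem continuousOn_regularizer (hδ : 0 < δ) :
    ContinuousOn (regularizer δ ε) (Set.Icc (0 : ℝ) 1) := by
  refine ContinuousOn.add (ContinuousOn.div (by fun_prop) (by fun_prop) fun r hr => ?_)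
    continuousOn_const
  have h1 := hr.1
  have h2 := sub_nonneg.mpr hr.2
  rcases h1.eq_or_lt with rfl | h1
  · simpa using hδ.ne'
  · positivity

theorem regularizer_le (hδ : 0 < δ) (hr : r ∈ Set.Ioc (0 : ℝ) 1) :
    regularizer δ ε r ≤ pullback id r + ε := by
  have h1 := hr.1
  have h2 := sub_nonneg.mpr hr.2
  rw [pullback, if_neg (not_le.mpr h1), regularizer, id, show r⁻¹ - 1 = (1 - r) / r by field_simp]
  gcongr
  exact le_add_of_nonneg_right (by positivity)

/-- Dropping ε gives e^{-ts}(1+δs)/s = e^{-ts}/s + δe^{-ts}, whose first term is ∫_t^∞ e^{-us} du.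
At r = 0 the left side vanishes; at r = 1 the integral is infinite. -/
theorem heatFun_div_regularizer_le (hδ : 0 < δ) (hε : 0 < ε) {t : ℝ} (ht : 0 < t)
    (hr : r ∈ Set.Icc (0 : ℝ) 1) :
    ENNReal.ofReal (heatFun t r / regularizer δ ε r) ≤
      (∫⁻ u in Set.Ioi t, ENNReal.ofReal (heatFun u r)) + ENNReal.ofReal δ := by
  rcases hr.1.eq_or_lt with rfl | h0
  · simp [heatFun_of_nonpos]
  rcases hr.2.eq_or_lt with rfl | h1
  · simp [heatFun_of_pos]
  have hs : 0 < r⁻¹ - 1 := sub_pos.mpr ((one_lt_inv₀ h0).mpr h1)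
  simp only [heatFun_of_pos h0]
  rw [lintegral_Ioi_exp_neg_mul hs, ← ENNReal.ofReal_add (by positivity) hδ.le]
  refine ENNReal.ofReal_le_ofReal ?_
  have he : Real.exp (-t * (r⁻¹ - 1)) ≤ 1 := Real.exp_le_one_iff.mpr (by nlinarith)
  have h2 : 0 < 1 - r := sub_pos.mpr h1
  calc Real.exp (-t * (r⁻¹ - 1)) / regularizer δ ε r
      ≤ Real.exp (-t * (r⁻¹ - 1)) / ((1 - r) / (r + δ * (1 - r))) := by
        gcongr
        exact le_add_of_nonneg_right hε.le
    _ = Real.exp (-t * (r⁻¹ - 1)) / (r⁻¹ - 1) + δ * Real.exp (-t * (r⁻¹ - 1)) := by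
        rw [show r⁻¹ - 1 = (1 - r) / r by field_simp]
        field_simp
    _ ≤ _ := by nlinarith

end HeatFunction

/-! ### Energy estimates for the heat operator. -/

section HeatOperator

variable {H : Type*} [NormedAddCommGroup H] [InnerProductSpace ℂ H] [CompleteSpace H]
  {A : H →ₗ.[ℂ] H} (hA : IsPositiveSelfAdjoint A)

theorem IsPositiveSelfAdjoint.heat_eq (t : ℝ) : hA.heat t = cfc (heatFun t) hA.resolvent := rfl

theorem IsPositiveSelfAdjoint.mem_Icc_of_mem_spectrum {r : ℝ}
    (hr : r ∈ spectrum ℝ hA.resolvent) : r ∈ Set.Icc (0 : ℝ) 1 :=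
  ⟨hA.nonneg_of_mem_spectrum hr, hA.le_one_of_mem_spectrum hr⟩

theorem IsPositiveSelfAdjoint.inner_heat_left (t : ℝ) (f k : H) :
    ⟪hA.heat t f, k⟫_ℂ = ⟪f, hA.heat t k⟫_ℂ := inner_cfc_left _ f k

theorem IsPositiveSelfAdjoint.ofReal_inner_heat {t : ℝ} (ht : 0 < t) (f : H) :
    ENNReal.ofReal (⟪hA.heat t f, f⟫_ℂ).re =
      ∫⁻ r, ENNReal.ofReal (heatFun t r) ∂(hA.resolventMeasure f) :=
  (lintegral_vectorMeasure _ f (continuous_heatFun ht).continuousOn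
    fun _ _ => heatFun_nonneg _ _).symm

theorem IsPositiveSelfAdjoint.lintegral_inner_heat {t : ℝ} (ht : 0 < t) (f : H) :
    ∫⁻ u in Set.Ioi t, ENNReal.ofReal (⟪hA.heat u f, f⟫_ℂ).re =
      ∫⁻ r, (∫⁻ u in Set.Ioi t, ENNReal.ofReal (heatFun u r)) ∂(hA.resolventMeasure f) := by
  rw [setLIntegral_congr_fun measurableSet_Ioi
    fun u hu => hA.ofReal_inner_heat (ht.trans hu) f]
  refine lintegral_lintegral_swap (Measurable.aemeasurable ?_)
  exact (measurable_heatFun.comp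
    (measurable_fst.prodMk (measurable_subtype_coe.comp measurable_snd))).ennreal_ofReal

theorem IsPositiveSelfAdjoint.lintegral_regularizer_le (f : H) {δ ε : ℝ} (hδ : 0 < δ) :
    ∫⁻ r, ENNReal.ofReal (regularizer δ ε r) ∂(hA.resolventMeasure f) ≤
      hA.energy f + ENNReal.ofReal ε * ‖f‖ₑ ^ 2 := by
  calc ∫⁻ r, ENNReal.ofReal (regularizer δ ε r) ∂(hA.resolventMeasure f)
      ≤ ∫⁻ r, (ENNReal.ofReal (pullback id r) + ENNReal.ofReal ε) ∂(hA.resolventMeasure f) := by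
        refine lintegral_mono_ae ?_
        -- The bound fails at r = 0, where `pullback` takes the value 0 but the regularizer is 1/δ +
        -- ε.
        filter_upwards [hA.ae_pos_resolventMeasure f] with r hr
        exact (ENNReal.ofReal_le_ofReal
          (regularizer_le hδ ⟨hr, hA.le_one_of_mem_spectrum r.2⟩)).trans ENNReal.ofReal_add_le
    _ ≤ _ := by
        rw [lintegral_add_right _ measurable_const, lintegral_const, vectorMeasure_univ]
        gcongr
        exact hA.lintegral_resolventMeasure_le_energy f

/-- Cauchy–Schwarz after splitting e^{-tA} = a(A)b(A), where a and b stand in for A^{1/2} and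
A^{-1/2}e^{-tA}. Squaring b doubles the time, hence the tail from 2t. -/
theorem IsPositiveSelfAdjoint.enorm_inner_heat_sq_le_regularized (f k : H) {t δ ε : ℝ}
    (ht : 0 < t) (hδ : 0 < δ) (hε : 0 < ε) :
    ‖⟪f, hA.heat t k⟫_ℂ‖ₑ ^ 2 ≤ (hA.energy f + ENNReal.ofReal ε * ‖f‖ₑ ^ 2) *
      ((∫⁻ u in Set.Ioi (2 * t), ENNReal.ofReal (⟪hA.heat u k, k⟫_ℂ).re) +
        ENNReal.ofReal δ * ‖k‖ₑ ^ 2) := by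
  have hR := hA.isSelfAdjoint_resolvent
  have hsub : spectrum ℝ hA.resolvent ⊆ Set.Icc (0 : ℝ) 1 :=
    fun r hr => hA.mem_Icc_of_mem_spectrum hr
  set a : ℝ → ℝ := fun r => Real.sqrt (regularizer δ ε r) with ha
  set b : ℝ → ℝ := fun r => heatFun t r / Real.sqrt (regularizer δ ε r) with hb
  have hpos : ∀ r ∈ spectrum ℝ hA.resolvent, 0 < regularizer δ ε r :=
    fun r hr => regularizer_pos hδ hε (hsub hr)
  have hac : ContinuousOn a (spectrum ℝ hA.resolvent) :=
    ((continuousOn_regularizer hδ).mono hsub).sqrt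
  have hbc : ContinuousOn b (spectrum ℝ hA.resolvent) :=
    (continuous_heatFun ht).continuousOn.div hac fun r hr => (Real.sqrt_pos.mpr (hpos r hr)).ne'
  have hab : hA.heat t k = cfc a hA.resolvent (cfc b hA.resolvent k) := by
    rw [← cfc_mul_apply hac hbc, hA.heat_eq]
    congr 1
    refine cfc_congr fun r hr => ?_
    have := (Real.sqrt_pos.mpr (hpos r hr)).ne'
    simp only [ha, hb]
    field_simp
  have h1 : ‖cfc a hA.resolvent f‖ₑ ^ 2 ≤ hA.energy f + ENNReal.ofReal ε * ‖f‖ₑ ^ 2 := by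
    rw [enorm_cfc_sq hR f hac]
    refine le_trans (le_of_eq (lintegral_congr fun r => ?_)) (hA.lintegral_regularizer_le f hδ)
    rw [ha, Real.sq_sqrt (hpos r r.2).le]
  have h2 : ‖cfc b hA.resolvent k‖ₑ ^ 2 ≤
      (∫⁻ u in Set.Ioi (2 * t), ENNReal.ofReal (⟪hA.heat u k, k⟫_ℂ).re) +
        ENNReal.ofReal δ * ‖k‖ₑ ^ 2 := by
    rw [enorm_cfc_sq hR k hbc, hA.lintegral_inner_heat (by positivity) k,
      ← vectorMeasure_univ hR k, ← lintegral_const, ← lintegral_add_right _ measurable_const]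
    refine lintegral_mono fun r => ?_
    rw [hb, div_pow, Real.sq_sqrt (hpos r r.2).le, heatFun_sq]
    exact heatFun_div_regularizer_le hδ hε (by positivity) (hsub r.2)
  rw [hab, ← inner_cfc_left]
  calc ‖⟪cfc a hA.resolvent f, cfc b hA.resolvent k⟫_ℂ‖ₑ ^ 2
      ≤ (‖cfc a hA.resolvent f‖ₑ * ‖cfc b hA.resolvent k‖ₑ) ^ 2 := by
        gcongr
        rw [← ofReal_norm, ← ofReal_norm, ← ofReal_norm, ← ENNReal.ofReal_mul (norm_nonneg _)]
        exact ENNReal.ofReal_le_ofReal (norm_inner_le_norm _ _)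
    _ ≤ _ := by
        rw [mul_pow]
        gcongr

/-- `|⟨f, e^{-tA} k⟩|² ≤ ℰ(f) ∫_{2t}^∞ ⟨e^{-uA} k, k⟩ du`. -/
theorem IsPositiveSelfAdjoint.enorm_inner_heat_sq_le (f k : H) {t : ℝ} (ht : 0 < t)
    (hf : hA.energy f ≠ ∞)
    (hk : ∫⁻ u in Set.Ioi (2 * t), ENNReal.ofReal (⟪hA.heat u k, k⟫_ℂ).re ≠ ∞) :
    ‖⟪f, hA.heat t k⟫_ℂ‖ₑ ^ 2 ≤ hA.energy f *
      ∫⁻ u in Set.Ioi (2 * t), ENNReal.ofReal (⟪hA.heat u k, k⟫_ℂ).re := by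
  have hlim (c d : ℝ≥0∞) (hd : d ≠ ∞) : Filter.Tendsto (fun x : ℝ => c + ENNReal.ofReal x * d)
      (nhdsWithin 0 (Set.Ioi 0)) (nhds c) := by
    have h0 : Filter.Tendsto (fun x : ℝ => ENNReal.ofReal x) (nhdsWithin 0 (Set.Ioi 0))
        (nhds 0) := by
      have := (ENNReal.continuous_ofReal.tendsto 0).mono_left
        (nhdsWithin_le_nhds (s := Set.Ioi (0 : ℝ)))
      rwa [ENNReal.ofReal_zero] at this
    simpa using (ENNReal.Tendsto.mul_const h0 (Or.inr hd)).const_add c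
  -- Take δ = ε → 0⁺; finiteness of both factors excludes the indeterminate 0 · ∞ in the limit.
  refine ge_of_tendsto (ENNReal.Tendsto.mul (hlim _ (‖f‖ₑ ^ 2) (by finiteness)) (Or.inr hk)
    (hlim _ (‖k‖ₑ ^ 2) (by finiteness)) (Or.inr hf)) ?_
  filter_upwards [self_mem_nhdsWithin] with x hx
  exact hA.enorm_inner_heat_sq_le_regularized f k ht hx hx

theorem IsPositiveSelfAdjoint.enorm_sub_heat_sq {t : ℝ} (ht : 0 < t) (f : H) :
    ‖f - hA.heat t f‖ₑ ^ 2 =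
      ∫⁻ r, ENNReal.ofReal ((1 - heatFun t r) ^ 2) ∂(hA.resolventMeasure f) := by
  have hR := hA.isSelfAdjoint_resolvent
  have hc := (continuous_heatFun ht).continuousOn (s := spectrum ℝ hA.resolvent)
  rw [← enorm_cfc_sq hR f (g := fun r => 1 - heatFun t r) (continuousOn_const.sub hc),
    cfc_sub _ _ _ continuousOn_const hc,
    cfc_const_one ℝ hA.resolvent]
  rfl

/-- `∫₀^∞ ‖f - e^{-tA} f‖² t⁻² dt ≤ 2 ln 2 ℰ(f)`. -/
theorem IsPositiveSelfAdjoint.lintegral_enorm_sub_heat_sq_le (f : H) :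
    ∫⁻ t in Set.Ioi 0, ENNReal.ofReal (t ^ 2)⁻¹ * ‖f - hA.heat t f‖ₑ ^ 2 ≤
      ENNReal.ofReal (2 * Real.log 2) * hA.energy f := by
  have hm : Measurable fun p : ℝ × spectrum ℝ hA.resolvent => heatFun p.1 p.2 :=
    measurable_heatFun.comp (measurable_fst.prodMk (measurable_subtype_coe.comp measurable_snd))
  have h1 : ∀ t ∈ Set.Ioi (0 : ℝ), ENNReal.ofReal (t ^ 2)⁻¹ * ‖f - hA.heat t f‖ₑ ^ 2 =
      ∫⁻ r, ENNReal.ofReal ((t ^ 2)⁻¹ * (1 - heatFun t r) ^ 2) ∂(hA.resolventMeasure f) := by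
    intro t ht
    rw [hA.enorm_sub_heat_sq ht, ← lintegral_const_mul' _ _ ENNReal.ofReal_ne_top]
    refine lintegral_congr fun r => ?_
    rw [ENNReal.ofReal_mul (by positivity)]
  rw [setLIntegral_congr_fun measurableSet_Ioi h1, lintegral_lintegral_swap]
  · have h2 : ∀ᵐ r : spectrum ℝ hA.resolvent ∂(hA.resolventMeasure f),
        ∫⁻ t in Set.Ioi 0, ENNReal.ofReal ((t ^ 2)⁻¹ * (1 - heatFun t r) ^ 2) =
          ENNReal.ofReal (2 * Real.log 2) * ENNReal.ofReal (pullback id r) := by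
      filter_upwards [hA.ae_pos_resolventMeasure f] with r hr
      have hs : 0 ≤ (r : ℝ)⁻¹ - 1 :=
        sub_nonneg.mpr ((one_le_inv₀ hr).mpr (hA.le_one_of_mem_spectrum r.2))
      simp only [heatFun_of_pos hr]
      rw [lintegral_one_sub_exp_sq hs, ENNReal.ofReal_mul (by positivity), pullback,
        if_neg (not_le.mpr hr), id]
    rw [lintegral_congr_ae h2, lintegral_const_mul' _ _ ENNReal.ofReal_ne_top]
    gcongr
    exact hA.lintegral_resolventMeasure_le_energy f
  · apply Measurable.aemeasurable
    unfold Function.uncurry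
    fun_prop

/-- A kernel vector is fixed by the resolvent, so ∫ (1-r)² against its spectral measure is zero; the
measure sits at r = 1, where the heat function is 1. -/
theorem IsPositiveSelfAdjoint.heat_of_mem_kernel {t : ℝ} (ht : 0 < t) {k : H}
    (hk : k ∈ kernel A) : hA.heat t k = k := by
  have hR := hA.isSelfAdjoint_resolvent
  obtain ⟨x, hx, rfl⟩ := hk
  have hx : A x = 0 := hx
  have hRx : hA.resolvent (x : H) = x := by
    have := hA.resolvent_add x
    rwa [hx, add_zero] at this
  have h0 : ∫⁻ r, ENNReal.ofReal ((1 - (r : ℝ)) ^ 2) ∂(hA.resolventMeasure (x : H)) = 0 := by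
    rw [← enorm_cfc_sq hR (x : H) (g := fun r => 1 - r) (by fun_prop),
      cfc_sub _ _ _ continuousOn_const (continuousOn_id' _), cfc_const_one ℝ hA.resolvent,
      cfc_id' ℝ hA.resolvent]
    change ‖(x : H) - hA.resolvent x‖ₑ ^ 2 = 0
    simp [hRx]
  rw [lintegral_eq_zero_iff (by fun_prop)] at h0
  have h1 : ‖(x : H) - hA.heat t x‖ₑ ^ 2 = 0 := by
    rw [hA.enorm_sub_heat_sq ht, lintegral_eq_zero_of_ae_eq_zero]
    filter_upwards [h0] with r hr
    have hr1 : (1 - (r : ℝ)) ^ 2 = 0 :=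
      le_antisymm (ENNReal.ofReal_eq_zero.mp hr) (sq_nonneg _)
    have hr2 : (r : ℝ) = 1 := by linarith [pow_eq_zero_iff two_ne_zero |>.mp hr1]
    simp [hr2, heatFun_of_pos]
  have h2 : (x : H) - hA.heat t x = 0 := by simpa using h1
  exact (sub_eq_zero.mp h2).symm

theorem IsPositiveSelfAdjoint.heat_mem_kerPerp {t : ℝ} (ht : 0 < t) {f : H}
    (hf : f ∈ kerPerp A) : hA.heat t f ∈ kerPerp A := by
  rw [Submodule.mem_orthogonal'] at hf ⊢
  intro k hk
  rw [hA.inner_heat_left, hA.heat_of_mem_kernel ht hk]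
  exact hf k hk

omit [CompleteSpace H] in
theorem inner_starProjection_of_mem {V : Submodule ℂ H} [V.HasOrthogonalProjection] {f : H}
    (hf : f ∈ V) (g : H) : ⟪f, V.starProjection g⟫_ℂ = ⟪f, g⟫_ℂ := by
  rw [← Submodule.inner_starProjection_left_eq_right, Submodule.starProjection_eq_self_iff.mpr hf]

end HeatOperator

/-! ### L¹–L^∞ duality within L², for an arbitrary measure. -/

section Duality

variable {X : Type*} [MeasurableSpace X] {μ : Measure X}

theorem lintegral_enorm_sq_eq (v : Lp ℂ 2 μ) : ∫⁻ x, ‖v x‖ₑ ^ 2 ∂μ = ‖v‖ₑ ^ 2 := by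
  rw [Lp.enorm_def, eLpNorm_eq_lintegral_rpow_enorm_toReal two_ne_zero ENNReal.ofNat_ne_top,
    ← ENNReal.rpow_natCast, ← ENNReal.rpow_mul]
  simp

theorem enorm_inner_le_eLpNorm_top_mul (v g : Lp ℂ 2 μ) :
    ‖⟪v, g⟫_ℂ‖ₑ ≤ eLpNorm v ∞ μ * eLpNorm g 1 μ := by
  rw [L2.inner_def, eLpNorm_one_eq_lintegral_enorm, eLpNorm_exponent_top,
    ← lintegral_const_mul'' _ (Lp.aestronglyMeasurable g).enorm]
  refine (enorm_integral_le_lintegral_enorm _).trans (lintegral_mono_ae ?_)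
  filter_upwards [enorm_ae_le_eLpNormEssSup v μ] with x hx
  calc ‖⟪v x, g x⟫_ℂ‖ₑ ≤ ‖v x‖ₑ * ‖g x‖ₑ := by
        rw [← ofReal_norm, ← ofReal_norm, ← ofReal_norm, ← ENNReal.ofReal_mul (norm_nonneg _)]
        exact ENNReal.ofReal_le_ofReal (norm_inner_le_norm _ _)
    _ ≤ _ := by gcongr

/-- Test with v·1_S normalized in L¹, where S = {|v| ≥ c}: the pairing is ∫_S|v|²/∫_S|v| ≥ c > D,
unless ∫_S|v| = 0. As c > 0, ∫_S|v| ≤ c⁻¹∫|v|² is finite, so no σ-finiteness is needed. -/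
theorem ae_enorm_lt_of_forall_inner_le {v : Lp ℂ 2 μ} {D c : ℝ≥0∞} (hDc : D < c)
    (h : ∀ g : Lp ℂ 2 μ, eLpNorm g 1 μ ≤ 1 → ‖⟪v, g⟫_ℂ‖ₑ ≤ D) : ∀ᵐ x ∂μ, ‖v x‖ₑ < c := by
  have hc : c ≠ 0 := (zero_le.trans_lt hDc).ne'
  have hvm : Measurable fun x => ‖v x‖ₑ := (Lp.stronglyMeasurable v).measurable.enorm
  set S : Set X := {x | c ≤ ‖v x‖ₑ} with hS
  have hSm : MeasurableSet S := measurableSet_le measurable_const hvm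
  set I : ℝ≥0∞ := ∫⁻ x in S, ‖v x‖ₑ ∂μ with hI
  set J : ℝ≥0∞ := ∫⁻ x in S, ‖v x‖ₑ ^ 2 ∂μ with hJ
  have hJtop : J ≠ ∞ := by
    refine ne_top_of_le_ne_top ?_ (setLIntegral_le_lintegral S _)
    rw [lintegral_enorm_sq_eq]
    finiteness
  have hcI : c * I ≤ J := by
    rw [hI, ← lintegral_const_mul _ hvm]
    refine setLIntegral_mono' hSm fun x hx => ?_
    rw [sq]
    exact mul_le_mul_left hx _
  have hItop : I ≠ ∞ := by
    intro hcon
    rw [hcon, ENNReal.mul_top hc] at hcI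
    exact hJtop (top_le_iff.mp hcI)
  have hI0 : I = 0 := by
    by_contra hI0
    have hmem : MemLp (S.indicator v) 2 μ := (Lp.memLp v).indicator hSm
    set g : Lp ℂ 2 μ := ((I.toReal⁻¹ : ℝ) : ℂ) • hmem.toLp with hg
    have hgae : ∀ᵐ x ∂μ, g x = ((I.toReal⁻¹ : ℝ) : ℂ) * S.indicator v x := by
      filter_upwards [Lp.coeFn_smul ((I.toReal⁻¹ : ℝ) : ℂ) hmem.toLp, hmem.coeFn_toLp] with x h1 h2
      rw [hg, h1, Pi.smul_apply, h2, smul_eq_mul]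
    have hscal : ‖((I.toReal⁻¹ : ℝ) : ℂ)‖ₑ = I⁻¹ := by
      rw [← ofReal_norm, Complex.norm_real, Real.norm_of_nonneg (by positivity),
        ENNReal.ofReal_inv_of_pos (ENNReal.toReal_pos hI0 hItop), ENNReal.ofReal_toReal hItop]
    have hg1 : eLpNorm g 1 μ ≤ 1 := by
      rw [eLpNorm_one_eq_lintegral_enorm]
      have h1 : ∀ᵐ x ∂μ, ‖g x‖ₑ = I⁻¹ * S.indicator (fun x => ‖v x‖ₑ) x := by
        filter_upwards [hgae] with x hx
        rw [hx, enorm_mul, hscal, enorm_indicator_eq_indicator_enorm]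
      rw [lintegral_congr_ae h1, lintegral_const_mul _ (hvm.indicator hSm),
        lintegral_indicator hSm, ← hI, ENNReal.inv_mul_cancel hI0 hItop]
    have hinner : ‖⟪v, g⟫_ℂ‖ₑ = I⁻¹ * J := by
      have h1 : ∀ᵐ x ∂μ, ⟪v x, g x⟫_ℂ =
          ((I.toReal⁻¹ : ℝ) : ℂ) * ((S.indicator (fun x => ‖v x‖ ^ 2) x : ℝ) : ℂ) := by
        filter_upwards [hgae] with x hx
        rw [hx]
        by_cases hxS : x ∈ S
        · simp only [hxS, Set.indicator_of_mem]
          rw [← smul_eq_mul, inner_smul_right, inner_self_eq_norm_sq_to_K, Complex.ofReal_pow]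
          rfl
        · simp [hxS]
      rw [L2.inner_def, integral_congr_ae h1, integral_const_mul, enorm_mul, hscal,
        integral_complex_ofReal, ← ofReal_norm, Complex.norm_real, Real.norm_of_nonneg,
        integral_indicator hSm, ofReal_integral_eq_lintegral_ofReal, hJ]
      · congr 1
        refine lintegral_congr fun x => ?_
        rw [ENNReal.ofReal_pow (norm_nonneg _), ofReal_norm]
      · exact ((Lp.memLp v).integrable_norm_pow two_ne_zero).integrableOn
      · exact Filter.Eventually.of_forall fun x => sq_nonneg _
      · exact integral_nonneg fun x => Set.indicator_nonneg (fun _ _ => sq_nonneg _) x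
    have h2 := h g hg1
    rw [hinner] at h2
    have h3 : c ≤ I⁻¹ * J := by
      calc c = I⁻¹ * (c * I) := by
            rw [mul_comm c, ← mul_assoc, ENNReal.inv_mul_cancel hI0 hItop, one_mul]
        _ ≤ _ := by gcongr
    exact absurd (h3.trans h2) (not_le.mpr hDc)
  have hμS : c * μ S ≤ 0 := by
    rw [← hI0, ← setLIntegral_const]
    exact setLIntegral_mono' hSm fun x hx => hx
  have hμS0 : μ S = 0 := (mul_eq_zero.mp (le_antisymm hμS zero_le)).resolve_left hc
  rw [ae_iff]
  simpa [hS] using hμS0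

/-- The duality between `L¹` and `L^∞`, on `L²`. -/
theorem ae_enorm_le_of_forall_inner_le {v : Lp ℂ 2 μ} {D : ℝ≥0∞}
    (h : ∀ g : Lp ℂ 2 μ, eLpNorm g 1 μ ≤ 1 → ‖⟪v, g⟫_ℂ‖ₑ ≤ D) : ∀ᵐ x ∂μ, ‖v x‖ₑ ≤ D := by
  rcases eq_or_ne D ∞ with rfl | hD
  · simp
  have hn (n : ℕ) : ∀ᵐ x ∂μ, ‖v x‖ₑ < D + (n : ℝ≥0∞)⁻¹ :=
    ae_enorm_lt_of_forall_inner_le (ENNReal.lt_add_right hD (by simp)) h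
  filter_upwards [ae_all_iff.mpr hn] with x hx
  have hlim : Filter.Tendsto (fun n : ℕ => D + (n : ℝ≥0∞)⁻¹) Filter.atTop (nhds D) := by
    simpa using ENNReal.tendsto_inv_nat_nhds_zero.const_add D
  exact ge_of_tendsto' hlim fun n => (hx n).le

end Duality

/-! ### Sup bounds, level sets and the inverse of M. -/

section Concrete

variable {X : Type*} [MeasurableSpace X] {μ : Measure X}
  {A : Lp ℂ 2 μ →ₗ.[ℂ] Lp ℂ 2 μ} (hA : IsPositiveSelfAdjoint A)

/-- The heat operator preserves V, so the projection in the second slot can be dropped; then Hölder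
applies. -/
theorem ofReal_inner_heat_starProjection_le {u : ℝ} (hu : 0 < u) {g : Lp ℂ 2 μ}
    (hg : eLpNorm g 1 μ ≤ 1) :
    ENNReal.ofReal (⟪hA.heat u ((kerPerp A).starProjection g),
      (kerPerp A).starProjection g⟫_ℂ).re ≤ heatDecay hA u := by
  have hmem : hA.heat u ((kerPerp A).starProjection g) ∈ kerPerp A :=
    hA.heat_mem_kerPerp hu (Submodule.starProjection_apply_mem _ _)
  rw [inner_starProjection_of_mem hmem]
  calc ENNReal.ofReal (⟪hA.heat u ((kerPerp A).starProjection g), g⟫_ℂ).re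
      ≤ ‖⟪hA.heat u ((kerPerp A).starProjection g), g⟫_ℂ‖ₑ := by
        rw [← ofReal_norm]
        exact ENNReal.ofReal_le_ofReal (Complex.re_le_norm _)
    _ ≤ eLpNorm (hA.heat u ((kerPerp A).starProjection g)) ∞ μ * 1 :=
        (enorm_inner_le_eLpNorm_top_mul _ _).trans (by gcongr)
    _ ≤ heatDecay hA u := by
        rw [mul_one]
        exact le_iSup₂ (f := fun (g : Lp ℂ 2 μ) (_ : eLpNorm g 1 μ ≤ 1) =>
          eLpNorm ((hA.heat u ∘L (kerPerp A).starProjection) g) ∞ μ) g hg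

/-- `‖e^{-tA} f‖_∞² ≤ ℰ(f) M(2t)` for `f ∈ V`. -/
theorem ae_enorm_heat_sq_le {t : ℝ} (ht : 0 < t) (hM : heatTail hA (2 * t) ≠ ∞) {f : Lp ℂ 2 μ}
    (hf : f ∈ kerPerp A) (hfE : hA.energy f ≠ ∞) :
    ∀ᵐ x ∂μ, ‖hA.heat t f x‖ₑ ^ 2 ≤ hA.energy f * heatTail hA (2 * t) := by
  have h : ∀ g : Lp ℂ 2 μ, eLpNorm g 1 μ ≤ 1 →
      ‖⟪hA.heat t f, g⟫_ℂ‖ₑ ≤ (hA.energy f * heatTail hA (2 * t)) ^ (1 / 2 : ℝ) := by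
    intro g hg
    have hle : ∫⁻ u in Set.Ioi (2 * t), ENNReal.ofReal
        (⟪hA.heat u ((kerPerp A).starProjection g), (kerPerp A).starProjection g⟫_ℂ).re ≤
          heatTail hA (2 * t) :=
      setLIntegral_mono' measurableSet_Ioi fun u hu =>
        ofReal_inner_heat_starProjection_le hA (lt_trans (by positivity) hu) hg
    -- As e^{-tA}f lies in V, g may be replaced by Π_V g; this brings in L, which controls the heat
    -- operator only on V.
    rw [← inner_starProjection_of_mem (hA.heat_mem_kerPerp ht hf), hA.inner_heat_left,
      one_div, ENNReal.le_rpow_inv_iff two_pos, ENNReal.rpow_two]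
    exact (hA.enorm_inner_heat_sq_le f _ ht hfE (ne_top_of_le_ne_top hM hle)).trans (by gcongr)
  filter_upwards [ae_enorm_le_of_forall_inner_le h] with x hx
  rwa [one_div, ENNReal.le_rpow_inv_iff two_pos, ENNReal.rpow_two] at hx

theorem heatTail_antitone : Antitone (heatTail hA) := fun _ _ h =>
  lintegral_mono_set (Set.Ioi_subset_Ioi h)

/-- On this set the sup bound gives |e^{-tA}f| ≤ |f|/2, so |f| ≤ 2|f - e^{-tA}f|; both factors 4 are
squares of this 2. -/
theorem setLIntegral_enorm_sq_le_sub_heat {t : ℝ} (ht : 0 < t) (hM : heatTail hA (2 * t) ≠ ∞)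
    {f : Lp ℂ 2 μ} (hf : f ∈ kerPerp A) (hfE : hA.energy f ≠ ∞) :
    ∫⁻ x in {x | 4 * hA.energy f * heatTail hA (2 * t) ≤ ‖f x‖ₑ ^ 2}, ‖f x‖ₑ ^ 2 ∂μ ≤
      4 * ‖f - hA.heat t f‖ₑ ^ 2 := by
  have hfm : Measurable fun x => ‖f x‖ₑ ^ 2 :=
    (Lp.stronglyMeasurable f).measurable.enorm.pow_const 2
  have hSm : MeasurableSet {x | 4 * hA.energy f * heatTail hA (2 * t) ≤ ‖f x‖ₑ ^ 2} :=
    measurableSet_le measurable_const hfm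
  rw [← lintegral_enorm_sq_eq, ← lintegral_const_mul' _ _ (by finiteness)]
  refine le_trans (lintegral_mono_ae ?_) (setLIntegral_le_lintegral
    {x | 4 * hA.energy f * heatTail hA (2 * t) ≤ ‖f x‖ₑ ^ 2} _)
  filter_upwards [ae_restrict_mem hSm, ae_restrict_of_ae (ae_enorm_heat_sq_le hA ht hM hf hfE),
    ae_restrict_of_ae (Lp.coeFn_sub f (hA.heat t f))] with x hx h1 h2
  rw [h2, Pi.sub_apply]
  have h3 : 4 * ‖hA.heat t f x‖ₑ ^ 2 ≤ ‖f x‖ₑ ^ 2 :=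
    le_trans (by rw [mul_assoc]; gcongr) hx
  have h4 : 2 * ‖hA.heat t f x‖ ≤ ‖f x‖ := by
    rw [← ofReal_norm, ← ofReal_norm, ← ENNReal.ofReal_pow (norm_nonneg _),
      ← ENNReal.ofReal_pow (norm_nonneg _), show (4 : ℝ≥0∞) = ENNReal.ofReal 4 by norm_num,
      ← ENNReal.ofReal_mul (by norm_num), ENNReal.ofReal_le_ofReal_iff (by positivity)] at h3
    refine (sq_le_sq₀ (by positivity) (norm_nonneg _)).mp ?_
    linarith
  rw [← ofReal_norm, ← ofReal_norm, ← ENNReal.ofReal_pow (norm_nonneg _),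
    ← ENNReal.ofReal_pow (norm_nonneg _), show (4 : ℝ≥0∞) = ENNReal.ofReal 4 by norm_num,
    ← ENNReal.ofReal_mul (by norm_num)]
  refine ENNReal.ofReal_le_ofReal ?_
  have h5 := norm_sub_norm_le (f x) (hA.heat t f x)
  have h6 : (‖f x‖) ^ 2 ≤ (2 * ‖f x - hA.heat t f x‖) ^ 2 := by
    gcongr
    linarith
  linarith

theorem lintegral_Ioi_inv_sq {a : ℝ} (ha : 0 < a) :
    ∫⁻ t in Set.Ioi a, ENNReal.ofReal (t ^ 2)⁻¹ = (ENNReal.ofReal a)⁻¹ := by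
  have h1 : ∀ t ∈ Set.Ioi a, ENNReal.ofReal (t ^ 2)⁻¹ = ENNReal.ofReal (t ^ (-2 : ℝ)) := by
    intro t ht
    have ht : 0 < t := ha.trans ht
    rw [Real.rpow_neg ht.le, Real.rpow_two]
  rw [setLIntegral_congr_fun measurableSet_Ioi h1, ← ofReal_integral_eq_lintegral_ofReal
    (integrableOn_Ioi_rpow_of_lt (by norm_num) ha), integral_Ioi_rpow_of_lt (by norm_num) ha,
    ← ENNReal.ofReal_inv_of_pos ha]
  · norm_num [Real.rpow_neg_one]
  · filter_upwards [ae_restrict_mem measurableSet_Ioi] with t ht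
    exact Real.rpow_nonneg (ha.trans ht).le _

/-- With zero energy the sup bound forces e^{-tA}f = 0 for every t > 0, and then ∫ t⁻²‖f‖² dt ≤ 0
gives f = 0. -/
theorem energy_ne_zero (hM : ∀ t : ℝ, 0 < t → heatTail hA t < ∞) {f : Lp ℂ 2 μ}
    (hf : f ∈ kerPerp A) (hf0 : f ≠ 0) : hA.energy f ≠ 0 := by
  intro hE
  have h1 : ∀ t ∈ Set.Ioi (0 : ℝ), ENNReal.ofReal (t ^ 2)⁻¹ * ‖f - hA.heat t f‖ₑ ^ 2 =
      ENNReal.ofReal (t ^ 2)⁻¹ * ‖f‖ₑ ^ 2 := by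
    intro t ht
    have ht : 0 < t := ht
    have h2 := ae_enorm_heat_sq_le hA ht (hM _ (by positivity)).ne hf (by simp [hE])
    have h3 : hA.heat t f = 0 := by
      refine (Lp.eq_zero_iff_ae_eq_zero).mpr ?_
      filter_upwards [h2] with x hx
      simpa [hE] using hx
    rw [h3, sub_zero]
  have h4 := hA.lintegral_enorm_sub_heat_sq_le f
  rw [setLIntegral_congr_fun measurableSet_Ioi h1, hE, mul_zero,
    lintegral_mul_const' _ _ (by finiteness), nonpos_iff_eq_zero, mul_eq_zero] at h4
  rcases h4 with h4 | h4
  · have h5 : ∫⁻ t in Set.Ioi (1 : ℝ), ENNReal.ofReal (t ^ 2)⁻¹ ≤ 0 :=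
      h4 ▸ lintegral_mono_set (Set.Ioi_subset_Ioi zero_le_one)
    rw [lintegral_Ioi_inv_sq one_pos] at h5
    simp at h5
  · exact hf0 (by simpa using h4)

/-- If M(t₀) ≤ y, monotonicity puts all t > t₀/2 in the set, and ∫_{t₀/2}^∞ t⁻² dt = 2/t₀. Inverting
the infimum into a supremum also covers the values 0 and ∞. -/
theorem inv_decreasingInverse_le {M : ℝ → ℝ≥0∞} (hM : Antitone M) (y : ℝ≥0∞) :
    (decreasingInverse M y)⁻¹ ≤
      2⁻¹ * ∫⁻ t in Set.Ioi 0, {t | M (2 * t) ≤ y}.indicator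
        (fun t => ENNReal.ofReal (t ^ 2)⁻¹) t := by
  unfold decreasingInverse
  simp only [ENNReal.inv_iInf]
  refine iSup_le fun t₀ => iSup_le fun ht₀ => iSup_le fun h => ?_
  have h1 : (ENNReal.ofReal t₀)⁻¹ = 2⁻¹ * (ENNReal.ofReal (t₀ / 2))⁻¹ := by
    rw [← ENNReal.mul_inv (by simp) (by simp), show (2 : ℝ≥0∞) = ENNReal.ofReal 2 by norm_num,
      ← ENNReal.ofReal_mul two_pos.le]
    congr 2
    ring
  rw [h1, ← lintegral_Ioi_inv_sq (half_pos ht₀)]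
  refine mul_le_mul' le_rfl (le_trans ?_
    (lintegral_mono_set (Set.Ioi_subset_Ioi (half_pos ht₀).le)))
  refine setLIntegral_mono' measurableSet_Ioi fun t ht => ?_
  have ht : t₀ / 2 < t := ht
  have hmem : t ∈ {t | M (2 * t) ≤ y} := (hM (by linarith : t₀ ≤ 2 * t)).trans h
  rw [Set.indicator_of_mem hmem]

end Concrete

/-! ### Integration over the levels t. -/

/-- The Sobolev inequality `∫ N(|f|² / 4 ℰ(f)) dμ ≤ ln 2` for `f ∈ V` of finite energy. -/
theorem lintegral_orliczN_le {X : Type*} [MeasurableSpace X] (μ : Measure X)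
    (A : Lp ℂ 2 μ →ₗ.[ℂ] Lp ℂ 2 μ) (hA : IsPositiveSelfAdjoint A)
    (hM : ∀ t : ℝ, 0 < t → heatTail hA t < ∞)
    (f : Lp ℂ 2 μ) (hfV : f ∈ kerPerp A) (hf0 : f ≠ 0)
    (hfE : hA.energy f < ∞) :
    ∫⁻ x, orliczN (heatTail hA) (‖f x‖ₑ ^ 2 / (4 * hA.energy f)) ∂μ
      ≤ ENNReal.ofReal (Real.log 2) := by
  have hE := hfE.ne
  have hE0 : hA.energy f ≠ 0 := energy_ne_zero hA hM hfV hf0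
  set E : ℝ≥0∞ := hA.energy f with hEdef
  have hfm : Measurable fun x => ‖f x‖ₑ ^ 2 :=
    (Lp.stronglyMeasurable f).measurable.enorm.pow_const 2
  set w : ℝ → ℝ≥0∞ := fun t => ENNReal.ofReal (t ^ 2)⁻¹ with hw
  set S : Set (X × ℝ) := {p | heatTail hA (2 * p.2) ≤ ‖f p.1‖ₑ ^ 2 / (4 * E)} with hS
  have hSm : MeasurableSet S :=
    measurableSet_le ((heatTail_antitone hA).measurable.comp (by fun_prop))
      ((hfm.comp measurable_fst).div_const _)
  have hF : Measurable (S.indicator fun p => w p.2) :=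
    Measurable.indicator (by fun_prop) hSm
  have hG : Measurable fun x => ∫⁻ t in Set.Ioi 0, S.indicator (fun p => w p.2) (x, t) :=
    hF.lintegral_prod_right'
  -- Tonelli needs an s-finite measure, which μ need not be; |f|²μ is finite.
  have hfin : IsFiniteMeasure (μ.withDensity fun x => ‖f x‖ₑ ^ 2) :=
    isFiniteMeasure_withDensity (by rw [lintegral_enorm_sq_eq]; finiteness)
  have hslice : ∀ t ∈ Set.Ioi (0 : ℝ),
      ∫⁻ x, S.indicator (fun p => w p.2) (x, t) ∂(μ.withDensity fun x => ‖f x‖ₑ ^ 2) ≤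
        4 * (w t * ‖f - hA.heat t f‖ₑ ^ 2) := by
    intro t ht
    have ht : 0 < t := ht
    have hsub : {x | (x, t) ∈ S} = {x | 4 * E * heatTail hA (2 * t) ≤ ‖f x‖ₑ ^ 2} := by
      ext x
      simp only [hS, Set.mem_ofPred_eq]
      rw [ENNReal.le_div_iff_mul_le (Or.inl (by simpa using hE0)) (Or.inl (by finiteness)),
        mul_comm]
    have hm : MeasurableSet {x | (x, t) ∈ S} := measurable_prodMk_right hSm
    calc ∫⁻ x, S.indicator (fun p => w p.2) (x, t) ∂(μ.withDensity fun x => ‖f x‖ₑ ^ 2)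
        = w t * ∫⁻ x in {x | (x, t) ∈ S}, ‖f x‖ₑ ^ 2 ∂μ := by
          rw [← withDensity_apply _ hm, ← lintegral_indicator_const hm]
          rfl
      _ ≤ w t * (4 * ‖f - hA.heat t f‖ₑ ^ 2) := by
          rw [hsub]
          gcongr
          exact setLIntegral_enorm_sq_le_sub_heat hA ht (hM _ (by positivity)).ne hfV hE
      _ = _ := by ring
  calc ∫⁻ x, orliczN (heatTail hA) (‖f x‖ₑ ^ 2 / (4 * E)) ∂μ
      ≤ ∫⁻ x, (4 * E)⁻¹ * 2⁻¹ * (‖f x‖ₑ ^ 2 *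
          ∫⁻ t in Set.Ioi 0, S.indicator (fun p => w p.2) (x, t)) ∂μ := by
        refine lintegral_mono fun x => ?_
        have h := inv_decreasingInverse_le (heatTail_antitone hA) (‖f x‖ₑ ^ 2 / (4 * E))
        calc orliczN (heatTail hA) (‖f x‖ₑ ^ 2 / (4 * E))
            ≤ ‖f x‖ₑ ^ 2 / (4 * E) * (2⁻¹ *
                ∫⁻ t in Set.Ioi 0, S.indicator (fun p => w p.2) (x, t)) := by
              rw [orliczN, div_eq_mul_inv]
              exact mul_le_mul' le_rfl h
          _ = _ := by
              rw [div_eq_mul_inv]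
              ring
    _ = (4 * E)⁻¹ * 2⁻¹ * ∫⁻ x, (∫⁻ t in Set.Ioi 0, S.indicator (fun p => w p.2) (x, t))
          ∂(μ.withDensity fun x => ‖f x‖ₑ ^ 2) := by
        rw [lintegral_const_mul _ (by fun_prop), lintegral_withDensity_eq_lintegral_mul _ hfm hG]
        rfl
    _ = (4 * E)⁻¹ * 2⁻¹ * ∫⁻ t in Set.Ioi 0, ∫⁻ x, S.indicator (fun p => w p.2) (x, t)
          ∂(μ.withDensity fun x => ‖f x‖ₑ ^ 2) := by
        rw [lintegral_lintegral_swap (f := fun x t => S.indicator (fun p => w p.2) (x, t))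
          hF.aemeasurable]
    _ ≤ (4 * E)⁻¹ * 2⁻¹ * ∫⁻ t in Set.Ioi 0, 4 * (w t * ‖f - hA.heat t f‖ₑ ^ 2) := by
        exact mul_le_mul' le_rfl (setLIntegral_mono' measurableSet_Ioi hslice)
    _ ≤ (4 * E)⁻¹ * 2⁻¹ * (4 * (ENNReal.ofReal (2 * Real.log 2) * E)) := by
        rw [lintegral_const_mul' _ _ (by finiteness)]
        gcongr
        exact hA.lintegral_enorm_sub_heat_sq_le f
    _ = ENNReal.ofReal (Real.log 2) := by
        rw [ENNReal.ofReal_mul two_pos.le, ENNReal.ofReal_ofNat,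
          show (4 * E)⁻¹ * 2⁻¹ * (4 * (2 * ENNReal.ofReal (Real.log 2) * E)) =
            ((4 * E)⁻¹ * (4 * E)) * (2⁻¹ * 2) * ENNReal.ofReal (Real.log 2) by ring,
          ENNReal.inv_mul_cancel (by simpa using hE0) (by finiteness),
          ENNReal.inv_mul_cancel two_ne_zero ENNReal.ofNat_ne_top, one_mul, one_mul]

end HeatSobolev

end

theorem mainTheorem6 {X : Type*} [MeasurableSpace X] (μ : Measure X)
    (A : Lp ℂ 2 μ →ₗ.[ℂ] Lp ℂ 2 μ) (hA : HeatSobolev.IsPositiveSelfAdjoint A)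
    (hL : ∀ t : ℝ, 0 < t → HeatSobolev.heatDecay hA t < ∞)
    (hM : ∀ t : ℝ, 0 < t → HeatSobolev.heatTail hA t < ∞)
    (f : Lp ℂ 2 μ) (hfV : f ∈ HeatSobolev.kerPerp A) (hf0 : f ≠ 0)
    (hfE : hA.energy f < ∞) :
    ∫⁻ x, HeatSobolev.orliczN (HeatSobolev.heatTail hA) (‖f x‖ₑ ^ 2 / (4 * hA.energy f)) ∂μ
      ≤ ENNReal.ofReal (Real.log 2) :=
  HeatSobolev.lintegral_orliczN_le μ A hA hM f hfV hf0 hfE
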